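/- Let $n\ge 0$ and consider all $2^n$ binary sequences $x=(x_1,\dots,x_n)\in\{0,1\}^n$, each with probability $2^{-n}$. Let $S^+(x)$ be the number of pairs $i>j$ with $x_i>x_j$, let $S^-(x)$ be the number of pairs $i>j$ with $x_i<x_j$, and let $S=S^+-S^-$. Write $\mu_k(n)$ for the $k$-th central moment of $S$ and $\sigma(n)=\sqrt{\mu_2(n)}$. Then: 1. For every $n$ the mean of $S$ is $0$, all odd moments vanish, $\mu_{2k+1}(n)=0$ for $k=0,1,2,\dots$, and $\sigma^2(n)=\dfrac{n(n^2-1)}{12}$. 2. For every $k=0,1,2,\dots$, $$\lim_{n\to\infty}\frac{\mu_{2k}(n)}{\sigma(n)^{2k}}=\frac{(2k)!}{2^k\,k!}.$$ 3. $S$ is asymptotically normal: $S/\sigma(n)$ converges in distribution to the standard normal law as $n\to\infty$, and for all real $S_1=S_1(n)\le S_2=S_2(n)$, which may depend on $n$, $$P\bigl(S_1\le S\le S_2\bigr)-\frac{1}{\sigma(n)\sqrt{2\pi}}\int_{S_1}^{S_2}e^{-t^2/(2\sigma^2(n))}\,dt\;\longrightarrow\;0\qquad(n\to\infty).$$ 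-/

import Mathlib

open Filter Topology MeasureTheory ProbabilityTheory

namespace KendallScore

/-- `S⁺(x)`: the number of pairs of positions `i > j` with `x i > x j`. -/
def scorePos {n ℓ : ℕ} (x : Fin n → Fin ℓ) : ℕ :=
  (Finset.univ.filter fun p : Fin n × Fin n => p.1 > p.2 ∧ x p.1 > x p.2).card

/-- `S⁻(x)`: the number of pairs of positions `i > j` with `x i < x j`. -/
def scoreNeg {n ℓ : ℕ} (x : Fin n → Fin ℓ) : ℕ :=
  (Finset.univ.filter fun p : Fin n × Fin n => p.1 > p.2 ∧ x p.1 < x p.2).card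

/-- The score `S = S⁺ - S⁻`. -/
def score {n ℓ : ℕ} (x : Fin n → Fin ℓ) : ℤ :=
  (scorePos x : ℤ) - (scoreNeg x : ℤ)

/-- The score as a real random variable on the space of all sequences of length `n` over `ℓ`
digits. -/
def scoreRV (ℓ n : ℕ) (x : Fin n → Fin ℓ) : ℝ :=
  (score x : ℝ)

/-- All `ℓ ^ n` sequences are equally likely. -/
noncomputable def equiprob (ℓ n : ℕ) : Measure (Fin n → Fin ℓ) :=
  uniformOn Set.univ

instance (ℓ n : ℕ) [NeZero ℓ] : IsProbabilityMeasure (equiprob ℓ n) := by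
  unfold equiprob
  infer_instance

/-- The `k`-th central moment `μ_k(n)` of the score. -/
noncomputable def mu (ℓ k n : ℕ) : ℝ :=
  centralMoment (scoreRV ℓ n) k (equiprob ℓ n)

/-- The standard deviation `σ(n) = √(μ_2(n))` of the score. -/
noncomputable def sigma (ℓ n : ℕ) : ℝ :=
  Real.sqrt (mu ℓ 2 n)

end KendallScore

namespace KendallScore

/-! For binary digits a pair `i > j` contributes exactly `x i - x j` to the score, so `S` is linear
in the digits. The coefficients sum to zero, so the digits can be recentred to signs: `S = ∑ w_i
ε_i` with independent `ε_i = ±1` and `w_i = (2i + 1 - n)/2`. Symmetry kills the odd moments, and `∑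
w_i ^ 2` is the variance.

The moment generating function of `S/σ` is therefore `∏ cosh (w_i z / σ)`. Since `|w_i| ≤ n` while
`σ` has order `n^(3/2)`, the normalized weights are uniformly small, and the product tends to `exp
(z ^ 2 / 2)` locally uniformly on `ℂ` (`tendstoLocallyUniformlyOn_complexMGF_score`). Derivatives at
`0` then give the moments, and values on the imaginary axis give the limit law. Moving endpoints are
handled by monotonicity and the continuity of the normal distribution function
(`tendsto_sub_of_monotone`). -/

/-- The sum of independent signs `±1` with weights `a i`, the signs being coded by binary digits. -/
def signSum {n : ℕ} (a : Fin n → ℝ) (x : Fin n → Fin 2) : ℝ :=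
  ∑ i, a i * (2 * ((x i : ℕ) : ℝ) - 1)

/-- The weights that make the binary score a sum of independent signs. -/
noncomputable def weight (n : ℕ) (i : Fin n) : ℝ := (2 * (i : ℝ) + 1 - n) / 2

lemma sum_cons_fin_two {M : Type*} [AddCommMonoid M] {n : ℕ} (f : (Fin (n + 1) → Fin 2) → M) :
    ∑ x, f x = ∑ y : Fin n → Fin 2, (f (Fin.cons 0 y) + f (Fin.cons 1 y)) := by
  rw [← (Fin.consEquiv fun _ => Fin 2).sum_comp, Fintype.sum_prod_type, Fin.sum_univ_two,
    ← Finset.sum_add_distrib]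
  rfl

lemma signSum_cons {n : ℕ} (a : Fin (n + 1) → ℝ) (d : Fin 2) (y : Fin n → Fin 2) :
    signSum a (Fin.cons d y) = a 0 * (2 * ((d : ℕ) : ℝ) - 1) + signSum (fun i => a i.succ) y := by
  simp [signSum, Fin.sum_univ_succ]

lemma sum_signSum_sq {n : ℕ} (a : Fin n → ℝ) :
    ∑ x, signSum a x ^ 2 = 2 ^ n * ∑ i, a i ^ 2 := by
  induction n with
  | zero => simp [signSum]
  | succ n ih =>
    rw [sum_cons_fin_two]
    have h (y : Fin n → Fin 2) : signSum a (Fin.cons 0 y) ^ 2 + signSum a (Fin.cons 1 y) ^ 2 =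
        2 * a 0 ^ 2 + 2 * signSum (fun i => a i.succ) y ^ 2 := by
      rw [signSum_cons, signSum_cons]
      simp
      ring
    simp_rw [h]
    rw [Finset.sum_add_distrib, ← Finset.mul_sum, ← Finset.mul_sum, ih, Fin.sum_univ_succ]
    simp
    ring

lemma sum_exp_signSum {n : ℕ} (a : Fin n → ℝ) (z : ℂ) :
    ∑ x, Complex.exp (z * signSum a x) = 2 ^ n * ∏ i, Complex.cosh (a i * z) := by
  induction n with
  | zero => simp [signSum]
  | succ n ih =>
    rw [sum_cons_fin_two]
    have h (y : Fin n → Fin 2) : Complex.exp (z * signSum a (Fin.cons 0 y)) +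
        Complex.exp (z * signSum a (Fin.cons 1 y)) =
        2 * Complex.cosh (a 0 * z) * Complex.exp (z * signSum (fun i => a i.succ) y) := by
      rw [signSum_cons, signSum_cons, Complex.two_cosh, add_mul, ← Complex.exp_add,
        ← Complex.exp_add, add_comm]
      congr 2 <;> simp <;> ring
    simp_rw [h]
    rw [← Finset.mul_sum, ih, Fin.prod_univ_succ]
    ring

lemma signSum_rev {n : ℕ} (a : Fin n → ℝ) (x : Fin n → Fin 2) :
    signSum a (fun i => (x i).rev) = -signSum a x := by
  rw [signSum, signSum, ← Finset.sum_neg_distrib]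
  refine Finset.sum_congr rfl fun i _ => ?_
  generalize x i = d
  fin_cases d <;> simp [Fin.rev] <;> ring

/-- Complementing every digit permutes the sequences and negates the sum. -/
lemma sum_signSum_odd_pow {n : ℕ} (a : Fin n → ℝ) (k : ℕ) :
    ∑ x, signSum a x ^ (2 * k + 1) = 0 := by
  have h : ∑ x, signSum a x ^ (2 * k + 1) = ∑ x, -signSum a x ^ (2 * k + 1) := by
    rw [← (Equiv.piCongrRight fun _ : Fin n => (Fin.revPerm : Equiv.Perm (Fin 2))).sum_comp]
    refine Finset.sum_congr rfl fun x _ => ?_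
    rw [← Odd.neg_pow ⟨k, rfl⟩, ← signSum_rev]
    rfl
  rw [Finset.sum_neg_distrib] at h
  linarith

/-! ### The binary score as a weighted sum of signs -/

/-- Index `i` is the larger member of `i` pairs and the smaller member of `n - 1 - i`; the
difference is its coefficient. -/
lemma sum_filter_lt_sub {n : ℕ} (f : Fin n → ℝ) :
    ∑ p : Fin n × Fin n, (if p.2 < p.1 then f p.1 - f p.2 else 0) =
      ∑ i : Fin n, (2 * (i : ℝ) + 1 - n) * f i := by
  have h : ∀ p : Fin n × Fin n, (if p.2 < p.1 then f p.1 - f p.2 else 0) =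
      (if p.2 < p.1 then f p.1 else 0) - (if p.2 < p.1 then f p.2 else 0) := by
    intro p; split_ifs <;> simp
  simp_rw [h]
  rw [Finset.sum_sub_distrib, Fintype.sum_prod_type, Fintype.sum_prod_type_right,
    ← Finset.sum_sub_distrib]
  refine Finset.sum_congr rfl fun i _ => ?_
  have h1 : (Finset.univ.filter fun j : Fin n => j < i).card = i := by
    rw [Finset.filter_gt_eq_Iio, Fin.card_Iio]
  have h2 : (Finset.univ.filter fun j : Fin n => i < j).card = n - 1 - i := by
    rw [Finset.filter_lt_eq_Ioi, Fin.card_Ioi]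
  dsimp only
  rw [← Finset.sum_filter, ← Finset.sum_filter, Finset.sum_const, Finset.sum_const]
  simp only [h1, h2, nsmul_eq_mul]
  rw [Nat.cast_sub (by omega), Nat.cast_sub (by omega)]
  push_cast
  ring

lemma sum_weight (n : ℕ) : ∑ i, weight n i = 0 := by
  have := sum_filter_lt_sub (n := n) fun _ => 1
  simp only [sub_self, ite_self, Finset.sum_const_zero, mul_one] at this
  simp only [weight]
  rw [← Finset.sum_div, ← this, zero_div]

lemma sum_weight_sq (n : ℕ) : ∑ i, weight n i ^ 2 = (n : ℝ) * ((n : ℝ) ^ 2 - 1) / 12 := by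
  -- The centre `c` is decoupled from the length `m` so that induction on `m` applies.
  have h (c : ℝ) (m : ℕ) : ∑ i ∈ Finset.range m, ((2 * (i : ℝ) + 1 - c) / 2) ^ 2 =
      (m : ℝ) * ((4 * (m : ℝ) ^ 2 - 1) / 3 - 2 * c * m + c ^ 2) / 4 := by
    induction m with
    | zero => simp
    | succ m ih => rw [Finset.sum_range_succ, ih]; push_cast; ring
  simp only [weight]
  rw [Fin.sum_univ_eq_sum_range (fun i : ℕ => ((2 * (i : ℝ) + 1 - n) / 2) ^ 2), h]
  ring

lemma abs_weight_le (n : ℕ) (i : Fin n) : |weight n i| ≤ n := by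
  have h1 : (i : ℝ) + 1 ≤ n := by exact_mod_cast i.2
  have h2 : (0 : ℝ) ≤ (i : ℕ) := Nat.cast_nonneg _
  rw [weight, abs_le]
  constructor <;> linarith

lemma scoreRV_two (n : ℕ) (x : Fin n → Fin 2) : scoreRV 2 n x = signSum (weight n) x := by
  have h1 : scoreRV 2 n x = ∑ p : Fin n × Fin n,
      (if p.2 < p.1 then ((x p.1 : ℕ) : ℝ) - ((x p.2 : ℕ) : ℝ) else 0) := by
    simp only [scoreRV, score, scorePos, scoreNeg, Finset.card_filter]
    push_cast
    rw [← Finset.sum_sub_distrib]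
    refine Finset.sum_congr rfl fun p _ => ?_
    by_cases hp : p.2 < p.1
    · generalize x p.1 = a
      generalize x p.2 = b
      fin_cases a <;> fin_cases b <;> simp [hp]
    · simp [hp]
  have h2 : signSum (weight n) x =
      ∑ i : Fin n, (2 * (i : ℝ) + 1 - n) * ((x i : ℕ) : ℝ) - ∑ i, weight n i := by
    rw [signSum, ← Finset.sum_sub_distrib]
    refine Finset.sum_congr rfl fun i _ => ?_
    rw [weight]
    ring
  rw [h1, h2, sum_filter_lt_sub fun i => ((x i : ℕ) : ℝ), sum_weight, sub_zero]

lemma integral_equiprob {E : Type*} [NormedAddCommGroup E] [NormedSpace ℝ E] [CompleteSpace E]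
    (n : ℕ) (f : (Fin n → Fin 2) → E) :
    ∫ x, f x ∂equiprob 2 n = ((2 : ℝ) ^ n)⁻¹ • ∑ x, f x := by
  rw [integral_fintype Integrable.of_finite, Finset.smul_sum]
  refine Finset.sum_congr rfl fun x _ => ?_
  simp [Measure.real, equiprob, uniformOn_univ]

lemma integral_scoreRV (n : ℕ) : ∫ x, scoreRV 2 n x ∂equiprob 2 n = 0 := by
  rw [integral_equiprob]
  simpa [scoreRV_two] using sum_signSum_odd_pow (weight n) 0

lemma mu_two_eq_integral (k n : ℕ) : mu 2 k n = ∫ x, scoreRV 2 n x ^ k ∂equiprob 2 n := by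
  simp [mu, centralMoment, integral_scoreRV]

lemma mu_odd (n k : ℕ) : mu 2 (2 * k + 1) n = 0 := by
  rw [mu_two_eq_integral, integral_equiprob]
  simp [scoreRV_two, sum_signSum_odd_pow]

lemma sigma_sq_eq_sum (n : ℕ) : sigma 2 n ^ 2 = ∑ i, weight n i ^ 2 := by
  have h : mu 2 2 n = ∑ i, weight n i ^ 2 := by
    rw [mu_two_eq_integral, integral_equiprob]
    simp [scoreRV_two, sum_signSum_sq]
  rw [sigma, h, Real.sq_sqrt (Finset.sum_nonneg fun i _ => sq_nonneg _)]

lemma sigma_sq (n : ℕ) : sigma 2 n ^ 2 = (n : ℝ) * ((n : ℝ) ^ 2 - 1) / 12 := by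
  rw [sigma_sq_eq_sum, sum_weight_sq]

lemma sigma_pos {n : ℕ} (hn : 2 ≤ n) : 0 < sigma 2 n := by
  have h : (2 : ℝ) ≤ n := by exact_mod_cast hn
  have : 0 < sigma 2 n ^ 2 := by
    rw [sigma_sq]
    have : 0 < (n : ℝ) ^ 2 - 1 := by nlinarith
    positivity
  exact (Real.sqrt_nonneg _).lt_of_ne fun h0 => by simp [sigma, ← h0] at this

lemma complexMGF_scoreRV_div (n : ℕ) (s : ℝ) (z : ℂ) :
    complexMGF (fun x => scoreRV 2 n x / s) (equiprob 2 n) z =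
      ∏ i, Complex.cosh ((weight n i / s : ℝ) * z) := by
  have h (x : Fin n → Fin 2) : scoreRV 2 n x / s = signSum (fun i => weight n i / s) x := by
    rw [scoreRV_two, signSum, signSum, Finset.sum_div]
    exact Finset.sum_congr rfl fun i _ => by ring
  simp only [complexMGF, h]
  rw [integral_equiprob, sum_exp_signSum, Complex.real_smul]
  push_cast
  rw [inv_mul_cancel_left₀ (pow_ne_zero n two_ne_zero)]

/-! ### Convergence of products of hyperbolic cosines -/

/-- Telescoping: factors are exchanged one at a time. Bounds of the form `exp (b i)` with `b i ≥ 0`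
keep every mixed partial product below `exp (∑ b i)`. -/
lemma norm_prod_sub_prod_le {ι : Type*} (s : Finset ι) (f g : ι → ℂ) (b : ι → ℝ)
    (hb : ∀ i, 0 ≤ b i) (hf : ∀ i, ‖f i‖ ≤ Real.exp (b i)) (hg : ∀ i, ‖g i‖ ≤ Real.exp (b i)) :
    ‖∏ i ∈ s, f i - ∏ i ∈ s, g i‖ ≤ (∑ i ∈ s, ‖f i - g i‖) * Real.exp (∑ i ∈ s, b i) := by
  classical
  induction s using Finset.induction_on with
  | empty => simp
  | insert a s ha ih =>
    rw [Finset.prod_insert ha, Finset.prod_insert ha, Finset.sum_insert ha, Finset.sum_insert ha]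
    have hF : ‖∏ i ∈ s, f i‖ ≤ Real.exp (∑ i ∈ s, b i) := by
      rw [norm_prod, Real.exp_sum]
      exact Finset.prod_le_prod (fun i _ => norm_nonneg _) fun i _ => hf i
    have h1 : 1 ≤ Real.exp (b a) := Real.one_le_exp (hb a)
    calc ‖f a * ∏ i ∈ s, f i - g a * ∏ i ∈ s, g i‖
        = ‖(f a - g a) * ∏ i ∈ s, f i + g a * (∏ i ∈ s, f i - ∏ i ∈ s, g i)‖ := by
          congr 1; ring
      _ ≤ ‖f a - g a‖ * ‖∏ i ∈ s, f i‖ + ‖g a‖ * ‖∏ i ∈ s, f i - ∏ i ∈ s, g i‖ := by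
          refine (norm_add_le _ _).trans_eq ?_
          rw [norm_mul, norm_mul]
      _ ≤ ‖f a - g a‖ * (Real.exp (b a) * Real.exp (∑ i ∈ s, b i)) +
          Real.exp (b a) * ((∑ i ∈ s, ‖f i - g i‖) * Real.exp (∑ i ∈ s, b i)) := by
          gcongr
          · exact hF.trans (le_mul_of_one_le_left (Real.exp_pos _).le h1)
          · exact hg a
      _ = (‖f a - g a‖ + ∑ i ∈ s, ‖f i - g i‖) * Real.exp (b a + ∑ i ∈ s, b i) := by
          rw [Real.exp_add]; ring

lemma norm_cosh_le (w : ℂ) : ‖Complex.cosh w‖ ≤ Real.exp (‖w‖ ^ 2 / 2) := by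
  calc ‖Complex.cosh w‖ ≤ Real.cosh w.re := by
        rw [Complex.cosh, Real.cosh_eq, norm_div, Complex.norm_ofNat]
        gcongr
        refine (norm_add_le _ _).trans_eq ?_
        rw [Complex.norm_exp, Complex.norm_exp, Complex.neg_re]
    _ ≤ Real.exp (w.re ^ 2 / 2) := Real.cosh_le_exp_half_sq _
    _ ≤ Real.exp (‖w‖ ^ 2 / 2) := by
        have := sq_le_sq' (by linarith [abs_le.1 (Complex.abs_re_le_norm w)])
          (abs_le.1 (Complex.abs_re_le_norm w)).2
        gcongr

lemma norm_exp_half_sq_le (w : ℂ) : ‖Complex.exp (w ^ 2 / 2)‖ ≤ Real.exp (‖w‖ ^ 2 / 2) := by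
  refine (Complex.norm_exp_le_exp_norm _).trans_eq ?_
  simp

/-- Both functions begin `1 + w ^ 2 / 2`, and the odd Taylor terms of `exp w` and `exp (-w)` cancel.
The remainders cost at most `5/96 + 1/4 < 1` times `‖w‖ ^ 4`. -/
lemma norm_cosh_sub_exp_half_sq_le {w : ℂ} (hw : ‖w‖ ≤ 1) :
    ‖Complex.cosh w - Complex.exp (w ^ 2 / 2)‖ ≤ ‖w‖ ^ 4 := by
  have h1 := Complex.exp_bound hw (n := 4) (by norm_num)
  have h2 := Complex.exp_bound (x := -w) (by simpa using hw) (n := 4) (by norm_num)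
  have h3 : ‖Complex.exp (w ^ 2 / 2) - 1 - w ^ 2 / 2‖ ≤ ‖w ^ 2 / 2‖ ^ 2 := by
    refine Complex.norm_exp_sub_one_sub_id_le ?_
    rw [norm_div, norm_pow, Complex.norm_ofNat]
    nlinarith [norm_nonneg w]
  rw [norm_div, norm_pow, Complex.norm_ofNat] at h3
  rw [norm_neg] at h2
  simp only [Finset.sum_range_succ, Finset.sum_range_zero, Nat.factorial] at h1 h2
  have key : Complex.cosh w - Complex.exp (w ^ 2 / 2) =
      ((Complex.exp w - (0 + w ^ 0 / ((1 : ℕ) : ℂ) + w ^ 1 / (((0 + 1) * 1 : ℕ) : ℂ) +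
        w ^ 2 / (((1 + 1) * ((0 + 1) * 1) : ℕ) : ℂ) +
        w ^ 3 / (((2 + 1) * ((1 + 1) * ((0 + 1) * 1)) : ℕ) : ℂ))) +
      (Complex.exp (-w) - (0 + (-w) ^ 0 / ((1 : ℕ) : ℂ) + (-w) ^ 1 / (((0 + 1) * 1 : ℕ) : ℂ) +
        (-w) ^ 2 / (((1 + 1) * ((0 + 1) * 1) : ℕ) : ℂ) +
        (-w) ^ 3 / (((2 + 1) * ((1 + 1) * ((0 + 1) * 1)) : ℕ) : ℂ)))) / 2 -
      (Complex.exp (w ^ 2 / 2) - 1 - w ^ 2 / 2) := by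
    rw [Complex.cosh]
    push_cast
    ring
  rw [key]
  refine (norm_sub_le _ _).trans ?_
  rw [norm_div, Complex.norm_ofNat]
  have h4 := norm_add_le _ _ |>.trans (add_le_add h1 h2)
  norm_num at h4 h3 ⊢
  nlinarith [pow_nonneg (norm_nonneg w) 4]

lemma norm_prod_cosh_sub_exp_le {ι : Type*} [Fintype ι] (a : ι → ℝ) (ha : ∑ i, a i ^ 2 = 1)
    {c : ℝ} (hc : ∀ i, |a i| ≤ c) {z : ℂ} (hz : c * ‖z‖ ≤ 1) :
    ‖∏ i, Complex.cosh (a i * z) - Complex.exp (z ^ 2 / 2)‖ ≤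
      c ^ 2 * (‖z‖ ^ 4 * Real.exp (‖z‖ ^ 2 / 2)) := by
  have hn (i : ι) : ‖(a i : ℂ) * z‖ = |a i| * ‖z‖ := by simp
  have h1 : Complex.exp (z ^ 2 / 2) = ∏ i, Complex.exp ((a i * z) ^ 2 / 2) := by
    rw [← Complex.exp_sum, ← Finset.sum_div]
    simp_rw [mul_pow]
    rw [← Finset.sum_mul]
    have : ∑ i, (a i : ℂ) ^ 2 = 1 := by exact_mod_cast ha
    rw [this, one_mul]
  have h2 : ∑ i, ‖(a i : ℂ) * z‖ ^ 2 / 2 = ‖z‖ ^ 2 / 2 := by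
    rw [← Finset.sum_div]
    simp_rw [hn, mul_pow, sq_abs]
    rw [← Finset.sum_mul, ha, one_mul]
  rw [h1]
  refine (norm_prod_sub_prod_le _ _ _ (fun i => ‖(a i : ℂ) * z‖ ^ 2 / 2) (fun i => by positivity)
    (fun i => norm_cosh_le _) (fun i => norm_exp_half_sq_le _)).trans ?_
  rw [h2, ← mul_assoc]
  gcongr
  calc ∑ i, ‖Complex.cosh (a i * z) - Complex.exp ((a i * z) ^ 2 / 2)‖
      ≤ ∑ i, c ^ 2 * a i ^ 2 * ‖z‖ ^ 4 := by
        refine Finset.sum_le_sum fun i _ => ?_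
        refine (norm_cosh_sub_exp_half_sq_le ?_).trans ?_
        · rw [hn]
          exact (mul_le_mul_of_nonneg_right (hc i) (norm_nonneg _)).trans hz
        · rw [hn, mul_pow]
          -- Spending one factor `a i ^ 2` on `c ^ 2` leaves a sum of squares, which is `1`.
          have : |a i| ^ 2 ≤ c ^ 2 := pow_le_pow_left₀ (abs_nonneg _) (hc i) 2
          calc |a i| ^ 4 * ‖z‖ ^ 4 = |a i| ^ 2 * |a i| ^ 2 * ‖z‖ ^ 4 := by ring
            _ ≤ c ^ 2 * |a i| ^ 2 * ‖z‖ ^ 4 := by gcongr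
            _ = _ := by rw [sq_abs]
    _ = c ^ 2 * ‖z‖ ^ 4 := by
        rw [← Finset.sum_mul, ← Finset.mul_sum, ha, mul_one]

/-- The moment generating functions of normalized sums of independent signs converge to that of the
standard normal law, if the weights are uniformly small. -/
lemma tendstoLocallyUniformlyOn_prod_cosh (a : (n : ℕ) → Fin n → ℝ) (c : ℕ → ℝ)
    (ha : ∀ᶠ n in atTop, ∑ i, a n i ^ 2 = 1) (hac : ∀ n i, |a n i| ≤ c n)
    (hc : Tendsto c atTop (𝓝 0)) :
    TendstoLocallyUniformlyOn (fun n z => ∏ i, Complex.cosh (a n i * z))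
      (fun z => Complex.exp (z ^ 2 / 2)) atTop Set.univ := by
  rw [tendstoLocallyUniformlyOn_iff_forall_isCompact isOpen_univ]
  intro K _ hK
  obtain ⟨R, hR⟩ := hK.isBounded.exists_norm_le
  have hR' : ∀ z ∈ K, ‖z‖ ≤ |R| := fun z hz => (hR z hz).trans (le_abs_self R)
  rw [Metric.tendstoUniformlyOn_iff]
  intro ε hε
  have h1 : Tendsto (fun n => |c n| * |R|) atTop (𝓝 0) := by
    simpa using hc.abs.mul_const |R|
  have h2 : Tendsto (fun n => |c n| ^ 2 * (|R| ^ 4 * Real.exp (|R| ^ 2 / 2))) atTop (𝓝 0) := by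
    have := (hc.abs.pow 2).mul_const (|R| ^ 4 * Real.exp (|R| ^ 2 / 2))
    rwa [abs_zero, zero_pow two_ne_zero, zero_mul] at this
  filter_upwards [ha, h1.eventually_le_const one_pos, h2.eventually_lt_const hε] with n hn h3 h4 z hz
  rw [dist_comm, dist_eq_norm]
  refine (norm_prod_cosh_sub_exp_le (a n) hn (c := |c n|)
    (fun i => (hac n i).trans (le_abs_self _)) ?_).trans_lt (lt_of_le_of_lt ?_ h4)
  · exact (mul_le_mul_of_nonneg_left (hR' z hz) (abs_nonneg _)).trans h3
  · have := hR' z hz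
    gcongr

/-! ### Moments from derivatives at the origin -/

lemma tendstoLocallyUniformlyOn_iteratedDeriv {F : ℕ → ℂ → ℂ} {f : ℂ → ℂ}
    (hF : ∀ n, Differentiable ℂ (F n)) (h : TendstoLocallyUniformlyOn F f atTop Set.univ) (m : ℕ) :
    TendstoLocallyUniformlyOn (fun n => iteratedDeriv m (F n)) (iteratedDeriv m f) atTop
      Set.univ := by
  induction m with
  | zero => simpa using h
  | succ m ih =>
    simp_rw [iteratedDeriv_succ]
    refine ih.deriv (Eventually.of_forall fun n => ?_) isOpen_univ
    exact ((hF n).contDiff (n := ⊤)).differentiable_iteratedDeriv m (by simp) |>.differentiableOn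

/-- Differentiating `f' = z f` repeatedly; at `z = 0` this is the recursion of the Gaussian moments.
-/
lemma iteratedDeriv_exp_half_sq (m : ℕ) (z : ℂ) :
    iteratedDeriv (m + 2) (fun z : ℂ => Complex.exp (z ^ 2 / 2)) z =
      z * iteratedDeriv (m + 1) (fun z : ℂ => Complex.exp (z ^ 2 / 2)) z +
        (m + 1) * iteratedDeriv m (fun z : ℂ => Complex.exp (z ^ 2 / 2)) z := by
  have hd : Differentiable ℂ (fun z : ℂ => Complex.exp (z ^ 2 / 2)) := by fun_prop
  have hm (m : ℕ) : Differentiable ℂ (iteratedDeriv m fun z : ℂ => Complex.exp (z ^ 2 / 2)) :=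
    (hd.contDiff (n := ⊤)).differentiable_iteratedDeriv m (by simp)
  have h1 (z : ℂ) : HasDerivAt (fun z : ℂ => Complex.exp (z ^ 2 / 2))
      (z * Complex.exp (z ^ 2 / 2)) z := by
    refine ((hasDerivAt_pow 2 z).div_const 2).cexp.congr_deriv ?_
    push_cast
    ring
  have h1' : iteratedDeriv 1 (fun z : ℂ => Complex.exp (z ^ 2 / 2)) =
      fun z => z * Complex.exp (z ^ 2 / 2) := by
    rw [iteratedDeriv_one]
    exact funext fun z => (h1 z).deriv
  induction m generalizing z with
  | zero =>
    rw [iteratedDeriv_succ, zero_add, h1']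
    have := ((hasDerivAt_id z).mul (h1 z)).deriv
    simp only [iteratedDeriv_zero, Nat.cast_zero, zero_add, one_mul]
    refine this.trans ?_
    simp
    ring
  | succ m ih =>
    have ih' : iteratedDeriv (m + 2) (fun z : ℂ => Complex.exp (z ^ 2 / 2)) = _ := funext ih
    rw [iteratedDeriv_succ, show m + 1 + 1 = m + 2 from rfl]
    nth_rw 1 [ih']
    have hs (k : ℕ) := (hm k z).hasDerivAt
    simp_rw [← iteratedDeriv_succ] at hs
    refine (((hasDerivAt_id z).mul (hs (m + 1))).add ((hs m).const_mul ((m : ℂ) + 1))).deriv.trans ?_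
    push_cast
    simp
    ring

lemma iteratedDeriv_exp_half_sq_zero (k : ℕ) :
    iteratedDeriv (2 * k) (fun z : ℂ => Complex.exp (z ^ 2 / 2)) 0 =
      ((2 * k).factorial : ℂ) / (2 ^ k * (k.factorial : ℂ)) := by
  induction k with
  | zero => simp
  | succ k ih =>
    rw [mul_add, mul_one, iteratedDeriv_exp_half_sq, ih, Nat.factorial_succ, Nat.factorial_succ,
      Nat.factorial_succ]
    have h1 : (k : ℂ) + 1 ≠ 0 := by exact_mod_cast k.succ_ne_zero
    have h2 : (k.factorial : ℂ) ≠ 0 := by exact_mod_cast k.factorial_ne_zero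
    push_cast
    field_simp
    ring

lemma sum_normalized_weight_sq {n : ℕ} (hn : 2 ≤ n) :
    ∑ i, (weight n i / sigma 2 n) ^ 2 = 1 := by
  simp_rw [div_pow]
  rw [← Finset.sum_div, ← sigma_sq_eq_sum]
  exact div_self (pow_ne_zero 2 (sigma_pos hn).ne')

lemma tendsto_div_sigma : Tendsto (fun n : ℕ => (n : ℝ) / sigma 2 n) atTop (𝓝 0) := by
  -- The square of the ratio is `12n / (n ^ 2 - 1)`, which is at most `16 / n` exactly when `n ^ 2 ≥
  -- 4`.
  have h1 : Tendsto (fun n : ℕ => (16 : ℝ) / n) atTop (𝓝 0) :=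
    tendsto_const_div_atTop_nhds_zero_nat _
  have h2 : Tendsto (fun n : ℕ => ((n : ℝ) / sigma 2 n) ^ 2) atTop (𝓝 0) := by
    refine squeeze_zero' (Eventually.of_forall fun n => sq_nonneg _) ?_ h1
    filter_upwards [eventually_ge_atTop 2] with n hn
    have h : (2 : ℝ) ≤ n := by exact_mod_cast hn
    have hs : 0 < sigma 2 n ^ 2 := pow_pos (sigma_pos hn) 2
    rw [div_pow, div_le_div_iff₀ hs (by linarith), sigma_sq]
    nlinarith [mul_nonneg (by linarith : (0 : ℝ) ≤ n) (by nlinarith : (0 : ℝ) ≤ (n : ℝ) ^ 2 - 4)]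
  have h3 := h2.sqrt
  simp_rw [Real.sqrt_sq_eq_abs] at h3
  rw [Real.sqrt_zero] at h3
  exact (tendsto_zero_iff_abs_tendsto_zero _).2 h3

lemma tendstoLocallyUniformlyOn_complexMGF_score :
    TendstoLocallyUniformlyOn
      (fun n z => complexMGF (fun x => scoreRV 2 n x / sigma 2 n) (equiprob 2 n) z)
      (fun z => Complex.exp (z ^ 2 / 2)) atTop Set.univ := by
  simp_rw [complexMGF_scoreRV_div]
  refine tendstoLocallyUniformlyOn_prod_cosh (fun n i => weight n i / sigma 2 n)
    (fun n => (n : ℝ) / sigma 2 n) ?_ (fun n i => ?_) tendsto_div_sigma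
  · filter_upwards [eventually_ge_atTop 2] with n hn using sum_normalized_weight_sq hn
  · have h := Real.sqrt_nonneg (mu 2 2 n)
    rw [abs_div, abs_of_nonneg (show 0 ≤ sigma 2 n from h)]
    exact div_le_div_of_nonneg_right (abs_weight_le n i) h

lemma tendsto_mu_even (k : ℕ) :
    Tendsto (fun n : ℕ => mu 2 (2 * k) n / sigma 2 n ^ (2 * k)) atTop
      (𝓝 (((2 * k).factorial : ℝ) / (2 ^ k * (k.factorial : ℝ)))) := by
  have hd (n : ℕ) : Differentiable ℂ
      (complexMGF (fun x => scoreRV 2 n x / sigma 2 n) (equiprob 2 n)) := by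
    rw [funext (complexMGF_scoreRV_div n (sigma 2 n))]
    fun_prop
  have h := (tendstoLocallyUniformlyOn_iteratedDeriv hd tendstoLocallyUniformlyOn_complexMGF_score
    (2 * k)).tendsto_at (Set.mem_univ 0)
  rw [iteratedDeriv_exp_half_sq_zero] at h
  have h1 (n : ℕ) : iteratedDeriv (2 * k)
      (complexMGF (fun x => scoreRV 2 n x / sigma 2 n) (equiprob 2 n)) 0 =
      ((mu 2 (2 * k) n / sigma 2 n ^ (2 * k) : ℝ) : ℂ) := by
    have h0 : integrableExpSet (fun x => scoreRV 2 n x / sigma 2 n) (equiprob 2 n) = Set.univ :=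
      Set.eq_univ_of_forall fun t => Integrable.of_finite
    rw [iteratedDeriv_complexMGF (by simp [h0]), mu_two_eq_integral, ← integral_div,
      ← integral_complex_ofReal]
    refine integral_congr_ae (Eventually.of_forall fun x => ?_)
    simp [div_pow]
  simp_rw [h1] at h
  rw [← tendsto_ofReal_iff]
  push_cast at h ⊢
  exact h

/-! ### Convergence in distribution and moving endpoints -/

lemma tendstoInDistribution_score : TendstoInDistribution
    (fun (n : ℕ) (x : Fin n → Fin 2) => scoreRV 2 n x / sigma 2 n)
    atTop (id : ℝ → ℝ) (fun n => equiprob 2 n) (gaussianReal 0 1) where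
  forall_aemeasurable n := (Measurable.of_discrete).aemeasurable
  tendsto := by
    refine ProbabilityMeasure.tendsto_iff_tendsto_charFun.2 fun t => ?_
    have h := tendstoLocallyUniformlyOn_complexMGF_score.tendsto_at
      (Set.mem_univ ((t : ℂ) * Complex.I))
    simp only [ProbabilityMeasure.coe_mk, Measure.map_id]
    have h1 (n : ℕ) := complexMGF_mul_I (μ := equiprob 2 n)
      (X := fun x => scoreRV 2 n x / sigma 2 n) (Measurable.of_discrete).aemeasurable t
    simp_rw [h1] at h
    convert h using 2
    rw [charFun_gaussianReal, mul_pow, Complex.I_sq]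
    congr 1
    push_cast
    ring

/-- Pointwise convergence of monotone functions to a continuous distribution function holds along
arbitrary sequences of arguments. -/
lemma tendsto_sub_of_monotone {F : ℕ → ℝ → ℝ} {Φ : ℝ → ℝ} (hF : ∀ n, Monotone (F n))
    (h0 : ∀ n x, 0 ≤ F n x) (h1 : ∀ n x, F n x ≤ 1) (hΦ : Continuous Φ)
    (hbot : Tendsto Φ atBot (𝓝 0)) (htop : Tendsto Φ atTop (𝓝 1))
    (hlim : ∀ x, Tendsto (fun n => F n x) atTop (𝓝 (Φ x))) (a : ℕ → ℝ) :
    Tendsto (fun n => F n (a n) - Φ (a n)) atTop (𝓝 0) := by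
  rw [tendsto_iff_ultrafilter]
  -- Along an ultrafilter `a` always converges in the compact space `EReal`, so only a finite limit
  -- and the two infinite ones need treatment.
  intro g hg
  have lower {y u : ℝ} (hu : ∀ᶠ n in (g : Filter ℕ), u < a n) (hy : y < Φ u) :
      ∀ᶠ n in (g : Filter ℕ), y < F n (a n) := by
    filter_upwards [hu, hg ((hlim u).eventually_const_lt hy)] with n h h' using
      lt_of_lt_of_le h' (hF n h.le)
  have upper {y u : ℝ} (hu : ∀ᶠ n in (g : Filter ℕ), a n < u) (hy : Φ u < y) :
      ∀ᶠ n in (g : Filter ℕ), F n (a n) < y := by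
    filter_upwards [hu, hg ((hlim u).eventually_lt_const hy)] with n h h' using
      lt_of_le_of_lt (hF n h.le) h'
  obtain ⟨L, -, hL⟩ := isCompact_univ.ultrafilter_le_nhds (g.map fun n => (a n : EReal)) (by simp)
  have hL : Tendsto (fun n => (a n : EReal)) g (𝓝 L) := hL
  suffices h : ∃ y, Tendsto (fun n => F n (a n)) g (𝓝 y) ∧ Tendsto (fun n => Φ (a n)) g (𝓝 y) by
    obtain ⟨y, hy1, hy2⟩ := h
    simpa using hy1.sub hy2
  induction L with
  | bot =>
    have ha : Tendsto a g atBot := by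
      rw [tendsto_atBot]
      intro b
      filter_upwards [hL.eventually_lt_const (EReal.bot_lt_coe b)] with n hn
      exact (EReal.coe_lt_coe_iff.1 hn).le
    refine ⟨0, tendsto_order.2 ⟨fun y hy => Eventually.of_forall fun n => hy.trans_le (h0 n _),
      fun y hy => ?_⟩, hbot.comp ha⟩
    obtain ⟨u, hu⟩ := (hbot.eventually_lt_const hy).exists
    exact upper (ha.eventually_lt_atBot u) hu
  | top =>
    have ha : Tendsto a g atTop := by
      rw [tendsto_atTop]
      intro b
      filter_upwards [hL.eventually_const_lt (EReal.coe_lt_top b)] with n hn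
      exact (EReal.coe_lt_coe_iff.1 hn).le
    refine ⟨1, tendsto_order.2 ⟨fun y hy => ?_,
      fun y hy => Eventually.of_forall fun n => (h1 n _).trans_lt hy⟩, htop.comp ha⟩
    obtain ⟨u, hu⟩ := (htop.eventually_const_lt hy).exists
    exact lower (ha.eventually_gt_atTop u) hu
  | coe x =>
    have ha : Tendsto a g (𝓝 x) := EReal.tendsto_coe.1 hL
    refine ⟨Φ x, tendsto_order.2 ⟨fun y hy => ?_, fun y hy => ?_⟩, (hΦ.tendsto x).comp ha⟩
    · obtain ⟨u, hu, hux⟩ := ((((hΦ.tendsto x).mono_left nhdsWithin_le_nhds).eventually_const_lt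
        hy).and (self_mem_nhdsWithin (s := Set.Iio x))).exists
      exact lower (ha.eventually_const_lt hux) hu
    · obtain ⟨u, hu, hux⟩ := ((((hΦ.tendsto x).mono_left nhdsWithin_le_nhds).eventually_lt_const
        hy).and (self_mem_nhdsWithin (s := Set.Ioi x))).exists
      exact upper (ha.eventually_lt_const hux) hu

lemma cdf_gaussian_sub (a b : ℝ) :
    cdf (gaussianReal 0 1) b - cdf (gaussianReal 0 1) a =
      ∫ t in a..b, gaussianPDFReal 0 1 t := by
  have h (x : ℝ) : cdf (gaussianReal 0 1) x = ∫ t in Set.Iic x, gaussianPDFReal 0 1 t := by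
    rw [cdf_eq_real, Measure.real, gaussianReal_apply_eq_integral _ one_ne_zero,
      ENNReal.toReal_ofReal (integral_nonneg fun t => gaussianPDFReal_nonneg _ _ _)]
  rw [h, h]
  exact intervalIntegral.integral_Iic_sub_Iic (integrable_gaussianPDFReal 0 1).integrableOn
    (integrable_gaussianPDFReal 0 1).integrableOn

lemma continuous_cdf_gaussian : Continuous (cdf (gaussianReal 0 1)) := by
  have h : (cdf (gaussianReal 0 1) : ℝ → ℝ) =
      fun b => cdf (gaussianReal 0 1) 0 + ∫ t in (0 : ℝ)..b, gaussianPDFReal 0 1 t := by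
    funext b
    rw [← cdf_gaussian_sub]
    ring
  rw [h]
  exact continuous_const.add (intervalIntegral.continuous_primitive
    (fun a b => (integrable_gaussianPDFReal 0 1).intervalIntegrable) 0)

lemma integral_exp_neg_sq_div {s : ℝ} (hs : 0 < s) (a b : ℝ) :
    1 / (s * Real.sqrt (2 * Real.pi)) * ∫ t in a..b, Real.exp (-t ^ 2 / (2 * s ^ 2)) =
      cdf (gaussianReal 0 1) (b / s) - cdf (gaussianReal 0 1) (a / s) := by
  rw [cdf_gaussian_sub]
  have h := intervalIntegral.integral_comp_div (a := a) (b := b) (gaussianPDFReal 0 1) hs.ne'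
  rw [smul_eq_mul] at h
  rw [← mul_right_inj' hs.ne', ← h, ← mul_assoc, ← intervalIntegral.integral_const_mul]
  refine intervalIntegral.integral_congr fun t _ => ?_
  have hs' := hs.ne'
  simp only [gaussianPDFReal, NNReal.coe_one, mul_one, sub_zero]
  congr 1
  · field_simp
  · congr 1
    field_simp

lemma tendsto_score_measure {A : Set ℝ} (hA : MeasurableSet A)
    (h : gaussianReal 0 1 (frontier A) = 0) :
    Tendsto (fun n : ℕ => (equiprob 2 n).real {x | scoreRV 2 n x / sigma 2 n ∈ A}) atTop
      (𝓝 ((gaussianReal 0 1).real A)) := by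
  have := ProbabilityMeasure.tendsto_measure_of_null_frontier_of_tendsto'
    tendstoInDistribution_score.tendsto (E := A) (by simpa [Measure.map_id] using h)
  simp only [ProbabilityMeasure.coe_mk, Measure.map_id] at this
  refine ((ENNReal.tendsto_toReal (measure_ne_top _ _)).comp this).congr fun n => ?_
  simp only [Function.comp]
  rw [Measure.map_apply Measurable.of_discrete hA]
  rfl

lemma tendsto_measure_Icc_score (S₁ S₂ : ℕ → ℝ) (hS : ∀ n, S₁ n ≤ S₂ n) :
    Tendsto (fun n : ℕ =>
      (equiprob 2 n).real {x | S₁ n ≤ scoreRV 2 n x ∧ scoreRV 2 n x ≤ S₂ n} -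
        1 / (sigma 2 n * Real.sqrt (2 * Real.pi)) *
          ∫ t in (S₁ n)..(S₂ n), Real.exp (-t ^ 2 / (2 * sigma 2 n ^ 2))) atTop (𝓝 0) := by
  have : NullSingletonClass (gaussianReal 0 1) := nullSingletonClass_gaussianReal one_ne_zero
  have hle : Tendsto (fun n => (equiprob 2 n).real {x | scoreRV 2 n x / sigma 2 n ≤
      S₂ n / sigma 2 n} - cdf (gaussianReal 0 1) (S₂ n / sigma 2 n)) atTop (𝓝 0) := by
    refine tendsto_sub_of_monotone
      (F := fun n t => (equiprob 2 n).real {x | scoreRV 2 n x / sigma 2 n ≤ t})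
      (fun n s t hst => measureReal_mono fun x hx => le_trans hx hst)
      (fun n t => measureReal_nonneg) (fun n t => measureReal_le_one) continuous_cdf_gaussian
      (tendsto_cdf_atBot _) (tendsto_cdf_atTop _) (fun t => ?_) fun n => S₂ n / sigma 2 n
    rw [cdf_eq_real]
    have hfr : gaussianReal 0 1 (frontier (Set.Iic t)) = 0 := by
      rw [frontier_Iic]
      exact measure_singleton t
    simpa only [Set.mem_Iic] using tendsto_score_measure measurableSet_Iic hfr
  -- The law of `S` has atoms, so the left endpoint needs the strict inequality: the closed interval
  -- is `{S ≤ S₂} \ {S < S₁}`.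
  have hlt : Tendsto (fun n => (equiprob 2 n).real {x | scoreRV 2 n x / sigma 2 n <
      S₁ n / sigma 2 n} - cdf (gaussianReal 0 1) (S₁ n / sigma 2 n)) atTop (𝓝 0) := by
    refine tendsto_sub_of_monotone
      (F := fun n t => (equiprob 2 n).real {x | scoreRV 2 n x / sigma 2 n < t})
      (fun n s t hst => measureReal_mono fun x hx => lt_of_lt_of_le hx hst)
      (fun n t => measureReal_nonneg) (fun n t => measureReal_le_one) continuous_cdf_gaussian
      (tendsto_cdf_atBot _) (tendsto_cdf_atTop _) (fun t => ?_) fun n => S₁ n / sigma 2 n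
    have hcdf : cdf (gaussianReal 0 1) t = (gaussianReal 0 1).real (Set.Iio t) := by
      rw [cdf_eq_real]
      exact (measureReal_congr Iio_ae_eq_Iic).symm
    rw [hcdf]
    have hfr : gaussianReal 0 1 (frontier (Set.Iio t)) = 0 := by
      rw [frontier_Iio]
      exact measure_singleton t
    simpa only [Set.mem_Iio] using tendsto_score_measure measurableSet_Iio hfr
  have h := hle.sub hlt
  rw [sub_zero] at h
  refine h.congr' ?_
  -- For `n ≤ 1` the deviation is `0` and the rescaling breaks down.
  filter_upwards [eventually_ge_atTop 2] with n hn
  have hs := sigma_pos hn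
  rw [integral_exp_neg_sq_div hs]
  simp_rw [div_le_div_iff_of_pos_right hs, div_lt_div_iff_of_pos_right hs]
  have hdiff : {x | S₁ n ≤ scoreRV 2 n x ∧ scoreRV 2 n x ≤ S₂ n} =
      {x | scoreRV 2 n x ≤ S₂ n} \ {x | scoreRV 2 n x < S₁ n} := by
    ext x
    simp [and_comm]
  have hsub : {x | scoreRV 2 n x < S₁ n} ⊆ {x | scoreRV 2 n x ≤ S₂ n} :=
    fun x hx => le_trans (le_of_lt hx) (hS n)
  rw [hdiff, measureReal_sdiff hsub .of_discrete]
  ring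

end KendallScore

theorem mainTheorem3 :
    -- the mean and all odd central moments vanish
    (∀ n : ℕ, (∫ x, KendallScore.scoreRV 2 n x ∂KendallScore.equiprob 2 n) = 0) ∧
    (∀ n k : ℕ, KendallScore.mu 2 (2 * k + 1) n = 0) ∧
    -- the variance
    (∀ n : ℕ, KendallScore.sigma 2 n ^ 2 = (n : ℝ) * ((n : ℝ) ^ 2 - 1) / 12) ∧
    -- convergence of the normalized even moments
    (∀ k : ℕ, Tendsto
      (fun n : ℕ => KendallScore.mu 2 (2 * k) n / KendallScore.sigma 2 n ^ (2 * k)) atTop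
      (𝓝 (((2 * k).factorial : ℝ) / (2 ^ k * (k.factorial : ℝ))))) ∧
    -- convergence in distribution of `S / σ(n)` to the standard normal law
    TendstoInDistribution
      (fun (n : ℕ) (x : Fin n → Fin 2) => KendallScore.scoreRV 2 n x / KendallScore.sigma 2 n)
      atTop (id : ℝ → ℝ) (fun n => KendallScore.equiprob 2 n) (gaussianReal 0 1) ∧
    -- the frequency of `S` between `S₁` and `S₂`, which may vary with `n`
    (∀ S₁ S₂ : ℕ → ℝ, (∀ n, S₁ n ≤ S₂ n) → Tendsto
      (fun n : ℕ =>
        (KendallScore.equiprob 2 n).real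
            {x | S₁ n ≤ KendallScore.scoreRV 2 n x ∧ KendallScore.scoreRV 2 n x ≤ S₂ n} -
          1 / (KendallScore.sigma 2 n * Real.sqrt (2 * Real.pi)) *
            ∫ t in (S₁ n)..(S₂ n), Real.exp (-t ^ 2 / (2 * KendallScore.sigma 2 n ^ 2)))
      atTop (𝓝 0)) :=
  ⟨KendallScore.integral_scoreRV, KendallScore.mu_odd, KendallScore.sigma_sq,
    KendallScore.tendsto_mu_even, KendallScore.tendstoInDistribution_score,
    KendallScore.tendsto_measure_Icc_score⟩
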